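/- For every integer $t\ge 2$ there is a constant $c>0$ such that the following holds for every integer $n\ge t$. Let $G$ be a finite simple graph on $n$ vertices with at least $n e^{c\sqrt{\log n}}$ edges ($\log$ is the natural logarithm), and let its edges be properly coloured with an arbitrary set of colours, that is, any two distinct edges sharing a vertex receive different colours. Then $G$ contains a rainbow subdivision of the complete graph $K_t$ in which each edge of $K_t$ is replaced by a path of length at most $1300(\log n)^2$. That is, there are $t$ distinct vertices $x_1,\dots,x_t$ of $G$ and, for all $1\le i<j\le t$, a path $P_{ij}$ in $G$ from $x_i$ to $x_j$ with at most $1300(\log n)^2$ edges, such that the only vertices among $x_1,\dots,x_t$ on $P_{ij}$ are $x_i$ and $x_j$, the paths of two different pairs have no common vertex outside $\{x_1,\dots,x_t\}$, and no two distinct edges of the union of all the paths $P_{ij}$ have the same colour. -/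

import Mathlib

universe u v

namespace RainbowSubdivision

/-- An edge colouring `χ` of `G` is proper if any two distinct edges that share a vertex
receive different colours. -/
def IsProper {V : Type u} {C : Type v} {G : SimpleGraph V} (χ : G.EdgeLabeling C) : Prop :=
  ∀ e f : G.edgeSet, e ≠ f → (∃ x : V, x ∈ (e : Sym2 V) ∧ x ∈ (f : Sym2 V)) → χ e ≠ χ f

/-- A subgraph `S` of `G` is rainbow if no two of its edges have the same colour. -/
def IsRainbow {V : Type u} {C : Type v} {G : SimpleGraph V} (χ : G.EdgeLabeling C)
    (S : G.Subgraph) : Prop :=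
  ∀ e f : G.edgeSet, (e : Sym2 V) ∈ S.edgeSet → (f : Sym2 V) ∈ S.edgeSet → χ e = χ f → e = f

/-- A subdivision of the complete graph `K_t` inside `G`: distinct branch vertices
`branch 0, …, branch (t - 1)`, and for every pair `i < j` a path of `G` from `branch i` to
`branch j` replacing the edge `ij` of `K_t`. No branch vertex is an inner vertex of one of the
paths, and the paths of two different pairs meet in branch vertices only. -/
structure CliqueSubdivision {V : Type u} (G : SimpleGraph V) (t : ℕ) where
  branch : Fin t ↪ V
  path : ∀ i j : Fin t, i < j → G.Path (branch i) (branch j)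
  branch_mem : ∀ (i j : Fin t) (h : i < j) (k : Fin t),
    branch k ∈ (path i j h : G.Walk (branch i) (branch j)).support → k = i ∨ k = j
  disjoint : ∀ (i j : Fin t) (h : i < j) (k l : Fin t) (h' : k < l), (i, j) ≠ (k, l) →
    ∀ x : V, x ∈ (path i j h : G.Walk (branch i) (branch j)).support →
      x ∈ (path k l h' : G.Walk (branch k) (branch l)).support → x ∈ Set.range branch

/-- The subgraph of `G` formed by a subdivision of `K_t`: all its branch vertices together with
the union of its paths. -/
def CliqueSubdivision.toSubgraph {V : Type u} {G : SimpleGraph V} {t : ℕ}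
    (D : CliqueSubdivision G t) : G.Subgraph :=
  (⨆ i : Fin t, G.singletonSubgraph (D.branch i)) ⊔
    ⨆ (i : Fin t) (j : Fin t) (h : i < j),
      (D.path i j h : G.Walk (D.branch i) (D.branch j)).toSubgraph

end RainbowSubdivision

namespace RainbowSubdivision

open Finset
open scoped Classical

/-! The density hypothesis enters only through an average degree of at least `10 ^ 13 * t ^ 2 * (log
n) ^ 10`. A vertex set `H` maximising edge density, discounted by a factor `1 + log #S`, is a robust
expander: small sets keep many outside neighbours even after many edges are deleted
(`exists_robustExpander`).

The crux is that any two vertices `x`, `y` of `H` are joined by a short rainbow path avoiding small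
given sets of vertices and colours (`exists_rainbow_path`). Colours are exposed at random in `l`
rounds, each colour with probability `1 / (2 * l)` per round. Unless it already fills half of `H`,
the set reached from `x` by rainbow walks in exposed colours grows in each round by a factor `1 + η
/ 2`, with tiny failure probability (`card_bad_reach_le`). So with probability above `1 / 2` more
than half of `H` is reached (`card_not_reach_half_lt`). Each colour is exposed with probability at
most `1 / 2`, so a permutation of the outcomes turns the colours exposed for `x` into an equally
distributed, disjoint set of colours for `y`. Some outcome is good for both ends; the two reached
sets then meet, and two walks with disjoint colour sets join into a rainbow one.

Any `t` vertices of `H` can then serve as branch vertices: the pairs are joined greedily, forbidding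
all vertices and colours already used (`exists_disjoint_rainbow_paths`). -/

/-! ### Robust expanders in dense graphs -/

/-- The ordered pairs of adjacent vertices inside `S`. -/
noncomputable def adjPairs {V : Type*} (G : SimpleGraph V) (S : Finset V) : Finset (V × V) :=
  (S ×ˢ S).filter fun p => G.Adj p.1 p.2

/-- Every set `B` of at most half of the vertices of `H` has at least `η * #B` neighbours in
`H \ B`, even after the deletion of any `δ * #B` edges. -/
def IsRobustExpander {V : Type*} (G : SimpleGraph V) (H : Finset V) (η δ : ℝ) : Prop :=
  ∀ B ⊆ H, B.Nonempty → 2 * #B ≤ #H → ∀ F : Finset (V × V), (#F : ℝ) ≤ δ * #B →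
    η * #B ≤ (#((H \ B).filter fun w => ∃ v ∈ B, G.Adj v w ∧ (v, w) ∉ F) : ℝ)

/-- An edge that meets `B` and is not in `F` in its direction out of `B` has both ends in `B` or its
neighbourhood. The factor 2 accounts for the two orientations of a deleted edge. -/
theorem card_adjPairs_le_of_deleted {V : Type*} (G : SimpleGraph V) (H B : Finset V)
    (F : Finset (V × V)) :
    #(adjPairs G H) ≤
      #(adjPairs G (B ∪ (H \ B).filter fun w => ∃ v ∈ B, G.Adj v w ∧ (v, w) ∉ F)) +
        #(adjPairs G (H \ B)) + 2 * #F := by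
  set N := (H \ B).filter fun w => ∃ v ∈ B, G.Adj v w ∧ (v, w) ∉ F with hN
  have hsub : adjPairs G H ⊆ adjPairs G (B ∪ N) ∪ adjPairs G (H \ B) ∪ (F ∪ F.image Prod.swap) := by
    rintro ⟨a, b⟩ hab
    simp only [adjPairs, mem_filter, mem_product] at hab
    obtain ⟨⟨ha, hb⟩, hadj⟩ := hab
    simp only [adjPairs, mem_union, mem_filter, mem_product, mem_image, mem_sdiff, hN, Prod.exists,
      Prod.swap_prod_mk, Prod.mk.injEq]
    by_cases haB : a ∈ B <;> by_cases hbB : b ∈ B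
    · simp [haB, hbB, hadj]
    · by_cases hF : (a, b) ∈ F
      · simp [hF]
      · refine Or.inl (Or.inl ⟨⟨Or.inl haB, Or.inr ⟨⟨hb, hbB⟩, a, haB, hadj, hF⟩⟩, hadj⟩)
    · by_cases hF : (b, a) ∈ F
      · exact Or.inr (Or.inr ⟨b, a, hF, rfl, rfl⟩)
      · refine Or.inl (Or.inl ⟨⟨Or.inr ⟨⟨ha, haB⟩, b, hbB, hadj.symm, hF⟩, Or.inl hbB⟩, hadj⟩)
    · exact Or.inl (Or.inr ⟨⟨⟨ha, haB⟩, hb, hbB⟩, hadj⟩)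
  calc #(adjPairs G H) ≤ _ := card_le_card hsub
    _ ≤ #(adjPairs G (B ∪ N)) + #(adjPairs G (H \ B)) + (#F + #(F.image Prod.swap)) :=
        (card_union_le _ _).trans (add_le_add (card_union_le _ _) (card_union_le _ _))
    _ ≤ _ := by
        have := card_image_le (s := F) (f := Prod.swap)
        omega

/-- `H` maximises average degree divided by `1 + log #S`. If `B` expanded badly, the edges of `H`
would be covered by `H \ B`, which is no denser than `H`, by the deleted edges, and by a set barely
larger than `B`. The latter is smaller than `H` by a constant factor, so by maximality it is
noticeably sparser than `H`: too few edges in total. -/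
theorem exists_robustExpander {V : Type*} [Fintype V] [Nonempty V] (G : SimpleGraph V) (d : ℝ)
    (hd : 0 < d) (hG : d * Fintype.card V ≤ #(adjPairs G univ)) :
    ∃ H : Finset V, H.Nonempty ∧ d / (1 + Real.log (Fintype.card V)) * #H ≤ #(adjPairs G H) ∧
      IsRobustExpander G H (1 / (6 * (1 + Real.log (Fintype.card V))))
        (d / (12 * (1 + Real.log (Fintype.card V)) ^ 2)) := by
  set n := Fintype.card V with hn
  have hnpos : (0 : ℝ) < n := by exact_mod_cast Fintype.card_pos
  set L : ℝ := 1 + Real.log n with hL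
  have hL1 : 1 ≤ L := by
    have := Real.log_natCast_nonneg n
    linarith
  let g : Finset V → ℝ := fun S => 1 + Real.log #S
  have hg1 : ∀ S, 1 ≤ g S := fun S => by
    have := Real.log_natCast_nonneg #S
    simp only [g]; linarith
  obtain ⟨H, hHne, hmax⟩ := exists_max_image (univ.filter fun S : Finset V => S.Nonempty)
    (fun S => (#(adjPairs G S) : ℝ) / (#S * g S)) ⟨univ, by simp⟩
  simp only [mem_filter, mem_univ, true_and] at hHne hmax
  have hh : (0 : ℝ) < #H := by exact_mod_cast hHne.card_pos
  have hgH : g H ≤ L := by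
    have : (#H : ℝ) ≤ n := by exact_mod_cast card_le_univ H
    have := Real.log_le_log hh this
    simp only [g, hL]
    linarith
  have hgHpos : 0 < g H := by linarith [hg1 H]
  set D : ℝ := #(adjPairs G H) / #H with hD
  have hDH : (#(adjPairs G H) : ℝ) = D * #H := by rw [hD]; field_simp
  have hDle : d / L ≤ D := by
    have h1 := hmax univ univ_nonempty
    have hgu : g univ = L := by simp [g, hL, hn]
    rw [hgu, card_univ, ← hn, div_le_div_iff₀ (mul_pos hnpos (by linarith)) (mul_pos hh hgHpos),
      hDH] at h1
    rw [div_le_iff₀ (by linarith)]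
    have h2 : d * n * (#H * g H) ≤ D * #H * (n * L) := 
      le_trans (mul_le_mul_of_nonneg_right hG (mul_pos hh hgHpos).le) h1
    have h3 : d * g H ≤ D * L := by
      have : (n * #H : ℝ) * (d * g H) ≤ (n * #H) * (D * L) := by linarith
      exact le_of_mul_le_mul_left this (mul_pos hnpos hh)
    nlinarith [hg1 H]
  have hDpos : 0 < D := lt_of_lt_of_le (by positivity) hDle
  have hsub : ∀ S : Finset V, (#(adjPairs G S) : ℝ) * g H ≤ D * #S * g S := by
    intro S
    rcases S.eq_empty_or_nonempty with rfl | hS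
    · simp [adjPairs]
    have hs : (0 : ℝ) < #S := by exact_mod_cast hS.card_pos
    have h1 := hmax S hS
    have hgS : 0 < g S := by linarith [hg1 S]
    rw [div_le_div_iff₀ (mul_pos hs hgS) (mul_pos hh hgHpos), hDH] at h1
    have : (#H : ℝ) * (#(adjPairs G S) * g H) ≤ #H * (D * #S * g S) := by linarith
    exact le_of_mul_le_mul_left this hh
  refine ⟨H, hHne, ?_, ?_⟩
  · rw [hDH]; exact mul_le_mul_of_nonneg_right hDle hh.le
  intro B hBH hBne hBhalf F hF
  set N := (H \ B).filter fun w => ∃ v ∈ B, G.Adj v w ∧ (v, w) ∉ F with hN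
  by_contra hcon
  push Not at hcon
  have hb : (0 : ℝ) < #B := by exact_mod_cast hBne.card_pos
  have hBhalf' : 2 * (#B : ℝ) ≤ #H := by exact_mod_cast hBhalf
  have hcount : (#(adjPairs G H) : ℝ) ≤ #(adjPairs G (B ∪ N)) + #(adjPairs G (H \ B)) + 2 * #F := by
    exact_mod_cast card_adjPairs_le_of_deleted G H B F
  have hBN : (#(B ∪ N) : ℝ) ≤ #B + #N := by exact_mod_cast card_union_le B N
  have hθ : 1 / (6 * L) * #B ≤ 1 / 6 * #B := by
    refine mul_le_mul_of_nonneg_right ?_ hb.le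
    exact one_div_le_one_div_of_le (by norm_num) (by linarith)
  have hBN' : (#(B ∪ N) : ℝ) ≤ 2 / 3 * #H := by linarith
  have hBNpos : (0 : ℝ) < #(B ∪ N) := by
    exact_mod_cast (hBne.mono subset_union_left).card_pos
  -- Uses `log (2 / 3) ≤ 2 / 3 - 1`.
  have hlog : g (B ∪ N) ≤ g H - 1 / 3 := by
    have h1 : Real.log #(B ∪ N) ≤ Real.log (2 / 3 * #H) := Real.log_le_log hBNpos hBN'
    rw [Real.log_mul (by norm_num) hh.ne'] at h1
    have h2 := Real.log_le_sub_one_of_pos (show (0 : ℝ) < 2 / 3 by norm_num)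
    simp only [g]; linarith
  have e1 : (#(adjPairs G (B ∪ N)) : ℝ) ≤ D * #(B ∪ N) * (1 - 1 / (3 * L)) := by
    have h1 := hsub (B ∪ N)
    have h2 : D * #(B ∪ N) * g (B ∪ N) ≤ D * #(B ∪ N) * ((1 - 1 / (3 * L)) * g H) := by
      refine mul_le_mul_of_nonneg_left ?_ (mul_pos hDpos hBNpos).le
      have : 1 / (3 * L) * g H ≤ 1 / 3 := by
        rw [div_mul_eq_mul_div, div_le_iff₀ (by positivity)]; linarith
      linarith
    have h3 := h1.trans h2
    rw [← mul_assoc] at h3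
    exact le_of_mul_le_mul_right h3 hgHpos
  have e2 : (#(adjPairs G (H \ B)) : ℝ) ≤ D * (#H - #B) := by
    have h1 := hsub (H \ B)
    have hc : (#(H \ B) : ℝ) = #H - #B := by
      rw [card_sdiff_of_subset hBH, Nat.cast_sub (card_le_card hBH)]
    have h2 : D * #(H \ B) * g (H \ B) ≤ D * #(H \ B) * g H := by
      have hpos : (0 : ℝ) < #(H \ B) := by rw [hc]; linarith
      have hle : (#(H \ B) : ℝ) ≤ #H := by linarith
      have := Real.log_le_log hpos hle
      refine mul_le_mul_of_nonneg_left ?_ (mul_pos hDpos hpos).le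
      simp only [g]
      linarith
    rw [← hc]
    exact le_of_mul_le_mul_right (h1.trans h2) hgHpos
  have e3 : (2 : ℝ) * #F ≤ D * (1 / (6 * L)) * #B := by
    have : d / (12 * L ^ 2) = d / L * (1 / (12 * L)) := by field_simp
    rw [this] at hF
    have h4 : d / L * (1 / (12 * L)) * #B ≤ D * (1 / (12 * L)) * #B :=
      mul_le_mul_of_nonneg_right (mul_le_mul_of_nonneg_right hDle (by positivity)) hb.le
    have h5 : (1 / (12 * L)) = 1 / 2 * (1 / (6 * L)) := by field_simp; norm_num
    rw [h5] at hF h4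
    linarith
  set θ : ℝ := 1 / (6 * L) with hθd
  have hθpos : 0 < θ := by positivity
  have hθ3 : 1 / (3 * L) = 2 * θ := by rw [hθd]; field_simp; norm_num
  have hθ6 : θ ≤ 1 / 6 := by
    rw [hθd]; exact one_div_le_one_div_of_le (by norm_num) (by linarith)
  rw [hθ3] at e1
  rw [hDH] at hcount
  -- The density loss `2 * θ` on `B ∪ N` outweighs the gain `θ` from the neighbours plus `θ` from
  -- the deleted edges: `(1 + θ) * (1 - 2 * θ) + θ < 1`.
  have h6 : D * #H ≤ D * (#(B ∪ N) * (1 - 2 * θ) + (#H - #B) + θ * #B) := by linarith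
  have h7 := le_of_mul_le_mul_left h6 hDpos
  have h8 : (#(B ∪ N) : ℝ) * (1 - 2 * θ) < (#B + θ * #B) * (1 - 2 * θ) := by
    apply mul_lt_mul_of_pos_right _ (by linarith)
    linarith
  nlinarith [mul_pos hb (mul_pos hθpos hθpos)]

/-! ### One round of random colour exposure -/

/-- Exponential moment bound for a weighted sum over a random set of colours. -/
theorem sum_exp_neg_le {K M : Type*} [Fintype K] [Fintype M] (o : M) (a : K → ℝ)
    (h0 : ∀ c, 0 ≤ a c) (h1 : ∀ c, a c ≤ 1) :
    ∑ u : K → M, Real.exp (-∑ c, if u c = o then a c else 0) ≤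
      (Fintype.card M : ℝ) ^ Fintype.card K *
        Real.exp (-(∑ c, a c) / (2 * Fintype.card M)) := by
  have hm : (0 : ℝ) < Fintype.card M := by exact_mod_cast Fintype.card_pos_iff.2 ⟨o⟩
  set m : ℝ := (Fintype.card M : ℝ) with hmd
  have hfac : ∀ c, ∑ j : M, Real.exp (-(if j = o then a c else 0)) ≤
      m * Real.exp (-(a c) / (2 * m)) := by
    intro c
    have e1 : ∑ j : M, Real.exp (-(if j = o then a c else 0)) = (m - 1) + Real.exp (-(a c)) := by
      have : ∀ j : M, Real.exp (-(if j = o then a c else 0)) =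
          1 + if j = o then Real.exp (-(a c)) - 1 else 0 := by
        intro j; split_ifs <;> simp
      simp only [this, sum_add_distrib, sum_ite_eq', mem_univ, if_true]
      simp [hmd]; ring
    have e2 : Real.exp (-(a c)) ≤ 1 - a c / 2 := by
      have h3 := Real.add_one_le_exp (a c)
      have h4 : Real.exp (-(a c)) * Real.exp (a c) = 1 := by rw [← Real.exp_add]; simp
      have h5 : 0 ≤ (1 - a c / 2) := by linarith [h1 c]
      have h6 : 1 ≤ (1 - a c / 2) * Real.exp (a c) := by nlinarith [h0 c, h1 c]
      exact le_of_mul_le_mul_right (h4.le.trans h6) (Real.exp_pos _)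
    have e3 : 1 - a c / (2 * m) ≤ Real.exp (-(a c) / (2 * m)) := by
      have := Real.add_one_le_exp (-(a c) / (2 * m))
      rw [neg_div] at this ⊢; linarith
    have e4 : m * (1 - a c / (2 * m)) = m - a c / 2 := by field_simp
    rw [e1]
    nlinarith
  calc ∑ u : K → M, Real.exp (-∑ c, if u c = o then a c else 0)
      = ∑ u : K → M, ∏ c, Real.exp (-(if u c = o then a c else 0)) := by
        refine sum_congr rfl fun u _ => ?_
        rw [← Real.exp_sum, sum_neg_distrib]
    _ = ∏ c, ∑ j : M, Real.exp (-(if j = o then a c else 0)) := by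
        rw [prod_univ_sum, Fintype.piFinset_univ]
    _ ≤ ∏ c : K, (m * Real.exp (-(a c) / (2 * m))) :=
        prod_le_prod (fun c _ => sum_nonneg fun _ _ => (Real.exp_pos _).le) fun c _ => hfac c
    _ = _ := by
        rw [prod_mul_distrib, prod_const, card_univ, ← Real.exp_sum, ← sum_div, sum_neg_distrib]

/-- If all colours of many edges at a vertex are tried, the vertex is rarely missed. -/
theorem card_missed_le {K M : Type*} [Fintype K] [Fintype M] (o : M) (T : Finset K) (k : ℕ)
    (hk : k ≤ #T) :
    (#(univ.filter fun u : K → M => ∀ c ∈ T, u c ≠ o) : ℝ) ≤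
      (Fintype.card M : ℝ) ^ Fintype.card K * Real.exp (-k / (2 * Fintype.card M)) := by
  have hm : (0 : ℝ) < Fintype.card M := by exact_mod_cast Fintype.card_pos_iff.2 ⟨o⟩
  have h := sum_exp_neg_le o (fun c : K => if c ∈ T then (1 : ℝ) else 0)
    (fun c => by split_ifs <;> norm_num) (fun c => by split_ifs <;> norm_num)
  have hsum : ∑ c : K, (if c ∈ T then (1 : ℝ) else 0) = #T := by simp
  rw [hsum] at h
  have hk' : (k : ℝ) ≤ #T := by exact_mod_cast hk
  calc (#(univ.filter fun u : K → M => ∀ c ∈ T, u c ≠ o) : ℝ)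
      = ∑ u ∈ univ.filter fun u : K → M => ∀ c ∈ T, u c ≠ o,
          Real.exp (-∑ c, if u c = o then (if c ∈ T then (1 : ℝ) else 0) else 0) := by
        rw [card_eq_sum_ones, Nat.cast_sum]
        refine sum_congr rfl fun u hu => ?_
        rw [mem_filter] at hu
        rw [sum_eq_zero]
        · simp
        · intro c _
          by_cases hc : c ∈ T
          · simp [hu.2 c hc]
          · simp [hc]
    _ ≤ _ := sum_le_univ_sum_of_nonneg fun _ => (Real.exp_pos _).le
    _ ≤ _ := h
    _ ≤ _ := by gcongr

/-- One round of exposing random colours: the set of vertices entered through an edge of `E` of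
an exposed colour is large, with few exceptions. -/
theorem card_bad_round_le {V K M : Type*} [Fintype K] [Fintype M] (o : M)
    (E : Finset (V × V)) (κ : V × V → K) (B : Finset V) (hBne : B.Nonempty)
    (hB : ∀ p ∈ E, p.1 ∈ B)
    (hfst : ∀ p ∈ E, ∀ q ∈ E, p.1 = q.1 → κ p = κ q → p = q)
    (hsnd : ∀ p ∈ E, ∀ q ∈ E, p.2 = q.2 → κ p = κ q → p = q)
    (η δ : ℝ) (hη : 0 < η) (hη1 : η ≤ 1) (k : ℕ) (hk : 0 < k)
    (hexp : ∀ F : Finset (V × V), (#F : ℝ) ≤ δ * #B → η * #B ≤ (#((E \ F).image Prod.snd) : ℝ)) :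
    (#(univ.filter fun u : K → M =>
      (#((E.filter fun p => u (κ p) = o).image Prod.snd) : ℝ) < η / 2 * #B) : ℝ) ≤
      (Fintype.card M : ℝ) ^ Fintype.card K *
        (2 * Real.exp (-k / (2 * Fintype.card M)) +
          Real.exp (1 - δ / (2 * Fintype.card M * k))) := by
  have hm : (0 : ℝ) < Fintype.card M := by exact_mod_cast Fintype.card_pos_iff.2 ⟨o⟩
  set m : ℝ := (Fintype.card M : ℝ) with hmd
  have hb : (0 : ℝ) < #B := by exact_mod_cast hBne.card_pos
  have hk0 : (0 : ℝ) < k := by exact_mod_cast hk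
  set Bad := univ.filter fun u : K → M =>
      (#((E.filter fun p => u (κ p) = o).image Prod.snd) : ℝ) < η / 2 * #B with hBad
  -- `F` collects the edges into heads of in-degree below `k`. If `F` is small, expansion survives
  -- its deletion and leaves many heads, each rarely missed. If `F` is large, its edges alone have
  -- many heads, at least `#F / k`.
  set F := E.filter fun p => #(E.filter fun q => q.2 = p.2) < k with hF
  have hX : (0 : ℝ) ≤ m ^ Fintype.card K := by positivity
  by_cases hc : (#F : ℝ) ≤ δ * #B
  · set W := (E \ F).image Prod.snd with hW
    have hWη := hexp F hc
    have hWpos : (0 : ℝ) < #W := lt_of_lt_of_le (mul_pos hη hb) hWη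
    have hmiss : ∀ w ∈ W, (#(Bad.filter fun u => ∀ p ∈ E, p.2 = w → u (κ p) ≠ o) : ℝ) ≤
        m ^ Fintype.card K * Real.exp (-k / (2 * m)) := by
      intro w hw
      obtain ⟨p, hp, rfl⟩ := mem_image.1 hw
      simp only [hF, mem_sdiff, mem_filter, not_and, not_lt] at hp
      have hcard : k ≤ #((E.filter fun q => q.2 = p.2).image κ) := by
        rw [card_image_of_injOn]
        · exact hp.2 hp.1
        · intro q hq r hr hqr
          simp only [coe_filter, Set.mem_ofPred_eq] at hq hr
          exact hsnd q hq.1 r hr.1 (hq.2.trans hr.2.symm) hqr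
      refine le_trans ?_ (card_missed_le o _ k hcard)
      refine Nat.cast_le.2 (card_le_card fun u hu => ?_)
      simp only [mem_filter, mem_univ, true_and, mem_image] at hu ⊢
      rintro c ⟨q, ⟨hq, hq2⟩, rfl⟩
      exact hu.2 q hq hq2
    -- A bad outcome misses at least half of `W`, so double counting (Markov) costs only a factor 2.
    have hhalf : ∀ u ∈ Bad, (#W : ℝ) / 2 ≤ #(W.filter fun w => ∀ p ∈ E, p.2 = w → u (κ p) ≠ o) := by
      intro u hu
      have hu' := (mem_filter.1 hu).2
      have hsub : W ⊆ ((E.filter fun p => u (κ p) = o).image Prod.snd) ∪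
          W.filter fun w => ∀ p ∈ E, p.2 = w → u (κ p) ≠ o := by
        intro w hw
        by_cases h : ∀ p ∈ E, p.2 = w → u (κ p) ≠ o
        · exact mem_union_right _ (mem_filter.2 ⟨hw, h⟩)
        · push Not at h
          obtain ⟨p, hp, rfl, hpo⟩ := h
          exact mem_union_left _ (mem_image_of_mem _ (mem_filter.2 ⟨hp, hpo⟩))
      have h1 : (#W : ℝ) ≤ #((E.filter fun p => u (κ p) = o).image Prod.snd) +
          #(W.filter fun w => ∀ p ∈ E, p.2 = w → u (κ p) ≠ o) := by
        exact_mod_cast (card_le_card hsub).trans (card_union_le _ _)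
      linarith
    have hdc : ∑ u ∈ Bad, (#(W.filter fun w => ∀ p ∈ E, p.2 = w → u (κ p) ≠ o) : ℝ) =
        ∑ w ∈ W, (#(Bad.filter fun u => ∀ p ∈ E, p.2 = w → u (κ p) ≠ o) : ℝ) := by
      simp only [card_filter, Nat.cast_sum]
      exact sum_comm
    have h1 : (#Bad : ℝ) * (#W / 2) ≤ #W * (m ^ Fintype.card K * Real.exp (-k / (2 * m))) := by
      rw [← nsmul_eq_mul, ← nsmul_eq_mul]
      exact (card_nsmul_le_sum _ _ _ hhalf).trans (hdc.le.trans (sum_le_card_nsmul _ _ _ hmiss))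
    have h2 : (#Bad : ℝ) ≤ m ^ Fintype.card K * (2 * Real.exp (-k / (2 * m))) := by
      have : (#W : ℝ) * #Bad ≤ #W * (m ^ Fintype.card K * (2 * Real.exp (-k / (2 * m)))) := by
        linarith
      exact le_of_mul_le_mul_left this hWpos
    refine h2.trans (mul_le_mul_of_nonneg_left ?_ hX)
    linarith [Real.exp_pos (1 - δ / (2 * m * k))]
  · push Not at hc
    set W := F.image Prod.snd with hW
    have hFW : #F ≤ k * #W := by
      refine card_le_mul_card_image _ _ fun w hw => ?_
      obtain ⟨p, hp, rfl⟩ := mem_image.1 hw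
      refine le_trans (card_le_card ?_) (mem_filter.1 hp).2.le
      exact filter_subset_filter _ (filter_subset _ _)
    have hFW' : (#F : ℝ) ≤ k * #W := by exact_mod_cast hFW
    have hch : ∀ w : V, ∃ p : V × V, w ∈ W → p ∈ E ∧ p.2 = w := by
      intro w
      by_cases hw : w ∈ W
      · obtain ⟨p, hp, h⟩ := mem_image.1 hw
        exact ⟨p, fun _ => ⟨(mem_filter.1 hp).1, h⟩⟩
      · exact ⟨(w, w), fun h => absurd h hw⟩
    choose e he using hch
    -- One edge is fixed per head. Edges of one colour have distinct tails, so dividing the colour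
    -- multiplicities by `#B` gives weights in `[0, 1]` for the moment bound.
    have hle : ∀ c, #(W.filter fun w => κ (e w) = c) ≤ #B := by
      intro c
      refine card_le_card_of_injOn (fun w => (e w).1) ?_ ?_
      · intro w hw
        exact hB _ (he w (mem_filter.1 hw).1).1
      · intro w hw w' hw' hww
        have h1 := mem_filter.1 hw
        have h2 := mem_filter.1 hw'
        have := hfst _ (he w h1.1).1 _ (he w' h2.1).1 hww (h1.2.trans h2.2.symm)
        rw [← (he w h1.1).2, ← (he w' h2.1).2, this]
    have hmom := sum_exp_neg_le o (fun c : K => (#(W.filter fun w => κ (e w) = c) : ℝ) / #B)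
      (fun c => by positivity)
      (fun c => by rw [div_le_one hb]; exact_mod_cast hle c)
    have hsum : ∑ c : K, (#(W.filter fun w => κ (e w) = c) : ℝ) / #B = #W / #B := by
      rw [← sum_div]
      congr 1
      rw [card_eq_sum_card_fiberwise (f := fun w => κ (e w)) (t := univ) (fun _ _ => mem_univ _)]
      push_cast; rfl
    rw [hsum] at hmom
    have hlow : ∀ u ∈ Bad, Real.exp (-1) ≤ Real.exp (-∑ c, if u c = o then
        (#(W.filter fun w => κ (e w) = c) : ℝ) / #B else 0) := by
      intro u hu
      have hu' := (mem_filter.1 hu).2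
      have h1 : ∑ c, (if u c = o then (#(W.filter fun w => κ (e w) = c) : ℝ) / #B else 0) =
          #(W.filter fun w => u (κ (e w)) = o) / #B := by
        have h2 : ∀ c, (if u c = o then (#(W.filter fun w => κ (e w) = c) : ℝ) / #B else 0) =
            #((W.filter fun w => u (κ (e w)) = o).filter fun w => κ (e w) = c) / #B := by
          intro c
          rw [filter_filter]
          split_ifs with h
          · congr 3
            ext w
            simp only [mem_filter]
            exact ⟨fun hw => ⟨hw.1, by rw [hw.2]; exact h, hw.2⟩, fun hw => ⟨hw.1, hw.2.2⟩⟩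
          · rw [filter_false_of_mem]
            · simp
            · rintro w _ ⟨h3, rfl⟩
              exact h h3
        simp only [h2]
        rw [← sum_div]
        congr 1
        rw [card_eq_sum_card_fiberwise (s := W.filter fun w => u (κ (e w)) = o)
          (f := fun w => κ (e w)) (t := univ) (fun _ _ => mem_univ _)]
        push_cast; rfl
      rw [h1]
      refine Real.exp_le_exp.2 (neg_le_neg ?_)
      rw [div_le_one hb]
      have h3 : #(W.filter fun w => u (κ (e w)) = o) ≤
          #((E.filter fun p => u (κ p) = o).image Prod.snd) := by
        refine card_le_card fun w hw => ?_
        have hw' := mem_filter.1 hw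
        exact mem_image.2 ⟨e w, mem_filter.2 ⟨(he w hw'.1).1, hw'.2⟩, (he w hw'.1).2⟩
      have h4 : (#(W.filter fun w => u (κ (e w)) = o) : ℝ) ≤
          #((E.filter fun p => u (κ p) = o).image Prod.snd) := by exact_mod_cast h3
      nlinarith
    have h1 : (#Bad : ℝ) * Real.exp (-1) ≤
        m ^ Fintype.card K * Real.exp (-(#W / #B) / (2 * m)) := by
      rw [← nsmul_eq_mul]
      exact (card_nsmul_le_sum _ _ _ hlow).trans
        ((sum_le_univ_sum_of_nonneg fun _ => (Real.exp_pos _).le).trans hmom)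
    have h2 : Real.exp (-(#W / #B) / (2 * m)) ≤ Real.exp (- (δ / (2 * m * k))) := by
      refine Real.exp_le_exp.2 ?_
      rw [neg_div]
      refine neg_le_neg ?_
      rw [div_div, div_le_div_iff₀ (by positivity) (by positivity)]
      nlinarith [mul_le_mul_of_nonneg_left (hc.le.trans hFW') (mul_pos two_pos hm).le]
    have h3 : (#Bad : ℝ) ≤ m ^ Fintype.card K * Real.exp (1 - δ / (2 * m * k)) := by
      have h4 := h1.trans (mul_le_mul_of_nonneg_left h2 hX)
      have h5 : Real.exp (1 - δ / (2 * m * k)) = Real.exp (- (δ / (2 * m * k))) * Real.exp 1 := by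
        rw [← Real.exp_add]; ring_nf
      have h6 : Real.exp (-1) * Real.exp 1 = 1 := by rw [← Real.exp_add]; simp
      calc (#Bad : ℝ) = #Bad * Real.exp (-1) * Real.exp 1 := by rw [mul_assoc, h6, mul_one]
        _ ≤ m ^ Fintype.card K * Real.exp (- (δ / (2 * m * k))) * Real.exp 1 :=
          mul_le_mul_of_nonneg_right h4 (Real.exp_pos _).le
        _ = _ := by rw [h5, mul_assoc]
    refine h3.trans (mul_le_mul_of_nonneg_left ?_ hX)
    linarith [Real.exp_pos (-k / (2 * m))]

/-- Resampling one coordinate of a uniformly random function. -/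
theorem card_mul_card_le_of_update {ι X : Type*} [Fintype ι] [DecidableEq ι] [Fintype X]
    (P : (ι → X) → Prop) (i : ι) (N : ℝ)
    (h : ∀ g : ι → X, (#(univ.filter fun x => P (Function.update g i x)) : ℝ) ≤ N) :
    (#(univ.filter P) : ℝ) * Fintype.card X ≤ N * Fintype.card (ι → X) := by
  have h1 : #((univ : Finset ((ι → X) × X)).filter fun q => P q.1) =
      #((univ : Finset ((ι → X) × X)).filter fun q => P (Function.update q.1 i q.2)) := by
    -- Swapping the coordinate `i` of the function with the spare sample is an involution.
    refine card_nbij' (fun q => (Function.update q.1 i q.2, q.1 i))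
      (fun q => (Function.update q.1 i q.2, q.1 i)) ?_ ?_ ?_ ?_
    all_goals intro q hq; simp_all
  have h2 : #((univ : Finset ((ι → X) × X)).filter fun q => P q.1) =
      #(univ.filter P) * Fintype.card X := by
    rw [← card_univ (α := X), ← card_product]
    congr 1
    ext q; simp
  have h3 : #((univ : Finset ((ι → X) × X)).filter fun q => P (Function.update q.1 i q.2)) =
      ∑ g : ι → X, #(univ.filter fun x => P (Function.update g i x)) := by
    simp only [card_filter]
    rw [Fintype.sum_prod_type]
  have h4 : ((#(univ.filter P) * Fintype.card X : ℕ) : ℝ) =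
      ∑ g : ι → X, (#(univ.filter fun x => P (Function.update g i x)) : ℝ) := by
    rw [← h2, h1, h3]; push_cast; rfl
  rw [← Nat.cast_mul, h4, mul_comm N, ← nsmul_eq_mul, ← card_univ]
  exact sum_le_card_nsmul _ _ _ fun g _ => h g

/-! ### Growth of the rainbow-reachable set -/

/-- The vertices that can be reached from `x` by a walk of length at most `i` inside `S` whose
edges have distinct colours in `A`. -/
noncomputable def reach {V K : Type*} [Fintype V] (G : SimpleGraph V) (κ : Sym2 V → K)
    (S : Finset V) (x : V) (A : Finset K) (i : ℕ) : Finset V :=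
  univ.filter fun v => ∃ p : G.Walk x v, p.length ≤ i ∧ (p.edges.map κ).Nodup ∧
    (∀ e ∈ p.edges, κ e ∈ A) ∧ ∀ w ∈ p.support, w ∈ S

/-- Edges of `G` at a common vertex have distinct values of `κ`. -/
def ProperOn {V K : Type*} (G : SimpleGraph V) (κ : Sym2 V → K) : Prop :=
  ∀ a b c, G.Adj a b → G.Adj a c → κ s(a, b) = κ s(a, c) → b = c

theorem mem_reach {V K : Type*} [Fintype V] {G : SimpleGraph V} {κ : Sym2 V → K}
    {S : Finset V} {x v : V} {A : Finset K} {i : ℕ} :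
    v ∈ reach G κ S x A i ↔ ∃ p : G.Walk x v, p.length ≤ i ∧ (p.edges.map κ).Nodup ∧
    (∀ e ∈ p.edges, κ e ∈ A) ∧ ∀ w ∈ p.support, w ∈ S := by
  simp [reach]

theorem self_mem_reach {V K : Type*} [Fintype V] {G : SimpleGraph V} {κ : Sym2 V → K}
    {S : Finset V} {x : V} (hx : x ∈ S) (A : Finset K) (i : ℕ) : x ∈ reach G κ S x A i :=
  mem_reach.2 ⟨.nil, by simp [hx]⟩

theorem reach_mono {V K : Type*} [Fintype V] {G : SimpleGraph V} {κ : Sym2 V → K}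
    {S : Finset V} {x : V} {A A' : Finset K} {i i' : ℕ} (hA : A ⊆ A') (hi : i ≤ i') :
    reach G κ S x A i ⊆ reach G κ S x A' i' := by
  intro v hv
  obtain ⟨p, h1, h2, h3, h4⟩ := mem_reach.1 hv
  exact mem_reach.2 ⟨p, h1.trans hi, h2, fun e he => hA (h3 e he), h4⟩

theorem reach_subset {V K : Type*} [Fintype V] {G : SimpleGraph V} {κ : Sym2 V → K}
    {S : Finset V} {x : V} {A : Finset K} {i : ℕ} : reach G κ S x A i ⊆ S := by
  intro v hv
  obtain ⟨p, _, _, _, h4⟩ := mem_reach.1 hv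
  exact h4 v p.end_mem_support

/-- Exposing one more random set of colours enlarges the set of reached vertices. -/
theorem card_bad_reach_le {V K M : Type*} [Fintype V] [Fintype K] [Fintype M] (o : M)
    (G : SimpleGraph V) (κ : Sym2 V → K) (hκ : ProperOn G κ) (H U : Finset V) (Q A : Finset K)
    (x : V) (hx : x ∈ H \ U) (η δ δ' : ℝ) (hη : 0 < η) (hη1 : η ≤ 1)
    (hH : IsRobustExpander G H η δ') (k : ℕ) (hk : 0 < k) (i : ℕ)
    (hδ : δ + #U + #Q + i ≤ δ')
    (hhalf : 2 * #(reach G κ (H \ U) x A i) ≤ #H) :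
    (#(univ.filter fun u : K → M =>
      (#(reach G κ (H \ U) x (A ∪ (univ.filter fun c => u c = o) \ Q) (i + 1)) : ℝ) <
        (1 + η / 2) * #(reach G κ (H \ U) x A i)) : ℝ) ≤
      (Fintype.card M : ℝ) ^ Fintype.card K *
        (2 * Real.exp (-k / (2 * Fintype.card M)) +
          Real.exp (1 - δ / (2 * Fintype.card M * k))) := by
  set B := reach G κ (H \ U) x A i with hBdef
  have hBne : B.Nonempty := ⟨x, self_mem_reach hx A i⟩
  have hb : (0 : ℝ) < #B := by exact_mod_cast hBne.card_pos
  have hch : ∀ v : V, ∃ T : Finset K, v ∈ B → #T ≤ i ∧ ∃ p : G.Walk x v, p.length ≤ i ∧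
      (p.edges.map κ).Nodup ∧ (∀ e ∈ p.edges, κ e ∈ A) ∧ (∀ w ∈ p.support, w ∈ H \ U) ∧
      ∀ e ∈ p.edges, κ e ∈ T := by
    intro v
    by_cases hv : v ∈ B
    · obtain ⟨p, h1, h2, h3, h4⟩ := mem_reach.1 hv
      refine ⟨(p.edges.map κ).toFinset, fun _ => ⟨?_, p, h1, h2, h3, h4, ?_⟩⟩
      · refine (List.toFinset_card_le _).trans ?_
        simpa using h1
      · intro e he
        simpa using ⟨e, he, rfl⟩
    · exact ⟨∅, fun h => absurd h hv⟩
  -- `T v` holds the colours of one fixed rainbow walk to `v`. It is chosen before the new round, so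
  -- the admissible edges `E` do not depend on `u`.
  choose T hT using hch
  let E : Finset (V × V) := (B ×ˢ ((H \ B) \ U)).filter fun p =>
    G.Adj p.1 p.2 ∧ κ s(p.1, p.2) ∉ Q ∧ κ s(p.1, p.2) ∉ T p.1
  -- The edges out of `B` that cannot extend the chosen walks. Properness bounds them by `#U + #Q +
  -- i` per vertex, which the robustness of `H` absorbs.
  let F₀ : Finset (V × V) := B.biUnion fun v =>
    (U ∪ univ.filter fun w => G.Adj v w ∧ κ s(v, w) ∈ Q ∪ T v).image fun w => (v, w)
  have hF₀ : (#F₀ : ℝ) ≤ #B * (#U + #Q + i) := by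
    have : #F₀ ≤ #B * (#U + (#Q + i)) := by
      refine card_biUnion_le_card_mul _ _ _ fun v hv => ?_
      refine card_image_le.trans ((card_union_le _ _).trans (Nat.add_le_add_left ?_ _))
      refine le_trans ?_ ((card_union_le Q (T v)).trans (Nat.add_le_add_left (hT v hv).1 _))
      refine card_le_card_of_injOn (fun w => κ s(v, w)) ?_ ?_
      · intro w hw
        exact (mem_filter.1 hw).2.2
      · intro w hw w' hw' h
        exact hκ v w w' (mem_filter.1 hw).2.1 (mem_filter.1 hw').2.1 h
    have h2 : (#F₀ : ℝ) ≤ #B * (#U + (#Q + i)) := by exact_mod_cast this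
    linarith
  have hE : ∀ p, p ∈ E ↔ (p.1 ∈ B ∧ ((p.2 ∈ H ∧ p.2 ∉ B) ∧ p.2 ∉ U)) ∧
      G.Adj p.1 p.2 ∧ κ s(p.1, p.2) ∉ Q ∧ κ s(p.1, p.2) ∉ T p.1 := by
    intro p; simp [E]
  have key := card_bad_round_le o E (fun p => κ s(p.1, p.2)) B hBne
    (fun p hp => ((hE p).1 hp).1.1) ?_ ?_ η δ hη hη1 k hk ?_
  · refine le_trans (Nat.cast_le.2 (card_le_card ?_)) key
    intro u hu
    simp only [mem_filter, mem_univ, true_and] at hu ⊢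
    set R := (E.filter fun p => u (κ s(p.1, p.2)) = o).image Prod.snd with hR
    have hdisj : Disjoint B R := by
      rw [disjoint_left]
      intro w hw hwR
      obtain ⟨p, hp, rfl⟩ := mem_image.1 hwR
      exact ((hE p).1 (mem_filter.1 hp).1).1.2.1.2 hw
    have hsub : B ∪ R ⊆
        reach G κ (H \ U) x (A ∪ (univ.filter fun c => u c = o) \ Q) (i + 1) := by
      refine union_subset (reach_mono subset_union_left (Nat.le_succ i)) ?_
      intro w hw
      obtain ⟨⟨v, w'⟩, hp, rfl⟩ := mem_image.1 hw
      obtain ⟨hpE, hpo⟩ := mem_filter.1 hp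
      obtain ⟨⟨hvB, ⟨hwH, hwB⟩, hwU⟩, hadj, hcQ, hcT⟩ := (hE _).1 hpE
      obtain ⟨-, p, h1, h2, h3, h4, h5⟩ := hT v hvB
      refine mem_reach.2 ⟨p.concat hadj, ?_, ?_, ?_, ?_⟩
      · simpa using h1
      · rw [SimpleGraph.Walk.edges_concat, List.concat_eq_append, List.map_append]
        refine List.nodup_append.2 ⟨h2, by simp, ?_⟩
        intro a ha b hb' hab
        obtain ⟨e, he, rfl⟩ := List.mem_map.1 ha
        simp only [List.map_cons, List.map_nil, List.mem_singleton] at hb'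
        rw [hb'] at hab
        exact hcT (hab ▸ h5 e he)
      · intro e he
        rw [SimpleGraph.Walk.edges_concat, List.concat_eq_append, List.mem_append] at he
        rcases he with he | he
        · exact mem_union_left _ (h3 e he)
        · rw [List.mem_singleton] at he
          subst he
          exact mem_union_right _ (mem_sdiff.2 ⟨by simpa using hpo, hcQ⟩)
      · intro z hz
        rw [SimpleGraph.Walk.support_concat, List.mem_append] at hz
        rcases hz with hz | hz
        · exact h4 z hz
        · rw [List.mem_singleton] at hz
          subst hz
          exact mem_sdiff.2 ⟨hwH, hwU⟩
    have hcard : (#B : ℝ) + #R ≤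
        #(reach G κ (H \ U) x (A ∪ (univ.filter fun c => u c = o) \ Q) (i + 1)) := by
      rw [← Nat.cast_add, ← card_union_of_disjoint hdisj]
      exact_mod_cast card_le_card hsub
    linarith
  · rintro ⟨a, b⟩ hp ⟨a', b'⟩ hq h h'
    obtain rfl : a = a' := h
    rw [hκ a b b' ((hE _).1 hp).2.1 ((hE _).1 hq).2.1 h']
  · rintro ⟨a, b⟩ hp ⟨a', b'⟩ hq h h'
    obtain rfl : b = b' := h
    simp only [Sym2.eq_swap (b := b)] at h'
    rw [hκ b a a' ((hE _).1 hp).2.1.symm ((hE _).1 hq).2.1.symm h']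
  · intro F hF
    refine (hH B (reach_subset.trans sdiff_subset) hBne hhalf (F ∪ F₀) ?_).trans ?_
    · have h1 : (#(F ∪ F₀) : ℝ) ≤ #F + #F₀ := by exact_mod_cast card_union_le _ _
      nlinarith [mul_le_mul_of_nonneg_right hδ hb.le]
    · refine Nat.cast_le.2 (card_le_card fun w hw => ?_)
      simp only [mem_filter, mem_sdiff, mem_union, not_or] at hw
      obtain ⟨⟨hwH, hwB⟩, v, hv, hadj, hvF, hvF₀⟩ := hw
      simp only [F₀, mem_biUnion, mem_image, mem_union, mem_filter, mem_univ, true_and,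
        Prod.mk.injEq, not_exists, not_and] at hvF₀
      have h3 := fun hh => hvF₀ v hv w hh rfl rfl
      refine mem_image.2 ⟨(v, w), mem_sdiff.2 ⟨(hE _).2 ⟨⟨hv, ⟨hwH, hwB⟩, ?_⟩, hadj, ?_, ?_⟩, hvF⟩, rfl⟩
      · exact fun h => h3 (Or.inl h)
      · exact fun h => h3 (Or.inr ⟨hadj, Or.inl h⟩)
      · exact fun h => h3 (Or.inr ⟨hadj, Or.inr h⟩)

/-- The colours exposed in the first `i` rounds. -/
noncomputable def exposed {K M : Type*} [Fintype K] (o : M) {l : ℕ} (g : Fin l → K → M) (i : ℕ) :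
    Finset K :=
  univ.filter fun c => ∃ j : Fin l, (j : ℕ) < i ∧ g j c = o

/-- If all rounds together are unlikely to fail, most choices of random colours reach more than
half of a robust expander. -/
theorem card_not_reach_half_lt {V K M : Type*} [Fintype V] [Fintype K] [Fintype M] (o : M)
    (G : SimpleGraph V) (κ : Sym2 V → K) (hκ : ProperOn G κ) (H U : Finset V) (Q : Finset K)
    (x : V) (hx : x ∈ H \ U) (η δ δ' : ℝ) (hη : 0 < η) (hη1 : η ≤ 1)
    (hH : IsRobustExpander G H η δ') (k : ℕ) (hk : 0 < k) (l : ℕ)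
    (hδ : δ + #U + #Q + l ≤ δ') (hl : (#H : ℝ) < (1 + η / 2) ^ l)
    (hfail : l * (2 * Real.exp (-k / (2 * Fintype.card M)) +
          Real.exp (1 - δ / (2 * Fintype.card M * k))) < 1 / 2) :
    (#(univ.filter fun g : Fin l → K → M =>
      2 * #(reach G κ (H \ U) x (exposed o g l \ Q) l) ≤ #H) : ℝ) <
        Fintype.card (Fin l → K → M) / 2 := by
  set ρ := 2 * Real.exp (-k / (2 * Fintype.card M)) +
          Real.exp (1 - δ / (2 * Fintype.card M * k)) with hρ
  let R : (Fin l → K → M) → ℕ → Finset V := fun g i => reach G κ (H \ U) x (exposed o g i \ Q) i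
  have hmono : ∀ g i j, i ≤ j → R g i ⊆ R g j := by
    intro g i j hij
    refine reach_mono (sdiff_subset_sdiff ?_ le_rfl) hij
    intro c hc
    obtain ⟨j', h1, h2⟩ := (mem_filter.1 hc).2
    exact mem_filter.2 ⟨mem_univ _, j', by omega, h2⟩
  obtain ⟨P, hPdef⟩ : ∃ P : Fin l → (Fin l → K → M) → Prop, ∀ i g, P i g ↔
      2 * #(R g i) ≤ #H ∧ (#(R g (i + 1)) : ℝ) < (1 + η / 2) * #(R g i) :=
    ⟨_, fun _ _ => Iff.rfl⟩
  have hX : (0 : ℝ) < Fintype.card (K → M) := by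
    exact_mod_cast Fintype.card_pos_iff.2 ⟨fun _ => o⟩
  -- The set reached before round `i` depends only on earlier rounds, so coordinate `i` may be
  -- resampled with the others fixed.
  have hP : ∀ i, (#(univ.filter (P i)) : ℝ) ≤ ρ * Fintype.card (Fin l → K → M) := by
    intro i
    have h1 := card_mul_card_le_of_update (P i) i (Fintype.card (K → M) * ρ) ?_
    · have : (Fintype.card (K → M) : ℝ) * #(univ.filter (P i)) ≤
          Fintype.card (K → M) * (ρ * Fintype.card (Fin l → K → M)) := by linarith
      exact le_of_mul_le_mul_left this hX
    intro g
    have hi : ∀ u, exposed o (Function.update g i u) i = exposed o g i := by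
      intro u
      ext c
      simp only [exposed, mem_filter, mem_univ, true_and]
      refine exists_congr fun j => and_congr_right fun hj => ?_
      rw [Function.update_of_ne]
      rintro rfl; exact lt_irrefl _ hj
    have hi1 : ∀ u, exposed o (Function.update g i u) (i + 1) \ Q =
        exposed o g i \ Q ∪ (univ.filter fun c => u c = o) \ Q := by
      intro u
      rw [← union_sdiff_distrib]
      congr 1
      rw [← hi u]
      ext c
      simp only [exposed, mem_filter, mem_univ, true_and, mem_union]
      constructor
      · rintro ⟨j, hj, hjo⟩
        by_cases h : j = i
        · subst h; right; simpa using hjo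
        · left; exact ⟨j, by have : (j : ℕ) ≠ i := fun h' => h (Fin.ext h')
                             omega, hjo⟩
      · rintro (⟨j, hj, hjo⟩ | h)
        · exact ⟨j, by omega, hjo⟩
        · exact ⟨i, by omega, by simpa using h⟩
    by_cases hhalf : 2 * #(R g i) ≤ #H
    · have hil : ((i : ℕ) : ℝ) ≤ l := by exact_mod_cast i.2.le
      have := card_bad_reach_le o G κ hκ H U Q (exposed o g i \ Q) x hx η δ δ' hη hη1 hH k hk i
        (by linarith) hhalf
      rw [Fintype.card_fun, Nat.cast_pow]
      refine le_trans (Nat.cast_le.2 (card_le_card ?_)) this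
      intro u hu
      simp only [mem_filter, mem_univ, true_and, hPdef, R, hi, hi1] at hu ⊢
      exact hu.2
    · rw [filter_false_of_mem]
      · simp only [card_empty, Nat.cast_zero]
        positivity
      · intro u _ hu
        have h := ((hPdef _ _).1 hu).1
        simp only [R, hi] at h
        exact hhalf h
  have hcover : (univ.filter fun g : Fin l → K → M => 2 * #(R g l) ≤ #H) ⊆
      univ.biUnion fun i => univ.filter (P i) := by
    intro g hg
    simp only [mem_filter, mem_univ, true_and] at hg
    by_contra hcon
    simp only [mem_biUnion, mem_filter, mem_univ, true_and, not_exists] at hcon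
    have hgrow : ∀ i ≤ l, (1 + η / 2) ^ i ≤ (#(R g i) : ℝ) := by
      intro i
      induction i with
      | zero =>
        intro _
        have : (R g 0).Nonempty := ⟨x, self_mem_reach hx _ _⟩
        rw [pow_zero]
        exact_mod_cast this.card_pos
      | succ i ih =>
        intro hi
        have h1 := hcon ⟨i, hi⟩
        have h2 : 2 * #(R g i) ≤ #H :=
          le_trans (Nat.mul_le_mul_left 2 (card_le_card (hmono g i l (by omega)))) hg
        simp only [hPdef, not_and, not_lt] at h1
        refine le_trans ?_ (h1 h2)
        rw [pow_succ, mul_comm]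
        exact mul_le_mul_of_nonneg_left (ih (by omega)) (by positivity)
    have h1 := hgrow l le_rfl
    have h2 : (#(R g l) : ℝ) ≤ #H := by
      exact_mod_cast card_le_card (reach_subset.trans sdiff_subset)
    linarith
  have hΩ : (0 : ℝ) < Fintype.card (Fin l → K → M) := by
    exact_mod_cast Fintype.card_pos_iff.2 ⟨fun _ _ => o⟩
  calc (#(univ.filter fun g : Fin l → K → M => 2 * #(R g l) ≤ #H) : ℝ)
      ≤ #(univ.biUnion fun i => univ.filter (P i)) := by exact_mod_cast card_le_card hcover
    _ ≤ ∑ i : Fin l, (#(univ.filter (P i)) : ℝ) := by exact_mod_cast card_biUnion_le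
    _ ≤ ∑ i : Fin l, ρ * Fintype.card (Fin l → K → M) := sum_le_sum fun i _ => hP i
    _ = (l * ρ) * Fintype.card (Fin l → K → M) := by simp; ring
    _ < 1 / 2 * Fintype.card (Fin l → K → M) := mul_lt_mul_of_pos_right hfail hΩ
    _ = _ := by ring

/-! ### Joining two vertices through disjoint colour sets -/

/-- A bijection from the outcomes satisfying `p` onto equally many of the others extends to a
permutation. This replaces independent splitting of the colours between the two ends. -/
theorem exists_perm_disjoint {Ω : Type*} [Fintype Ω] (p : Ω → Prop) [DecidablePred p]
    (h : 2 * #(univ.filter p) ≤ Fintype.card Ω) :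
    ∃ σ : Equiv.Perm Ω, ∀ ω, p ω → ¬ p (σ ω) := by
  have h1 : #(univ.filter p) ≤ #(univ.filter fun ω => ¬ p ω) := by
    have := card_filter_add_card_filter_not (s := (univ : Finset Ω)) p
    rw [card_univ] at this
    omega
  obtain ⟨T, hT, hcard⟩ := exists_subset_card_eq h1
  have hc : Fintype.card {ω // p ω} = Fintype.card {ω // ω ∈ T} := by
    rw [Fintype.card_subtype, Fintype.card_coe, hcard]
  let e : {ω // p ω} ≃ {ω // ω ∈ T} := Fintype.equivOfCardEq hc
  refine ⟨e.extendSubtype, fun ω hω => ?_⟩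
  exact (mem_filter.1 (hT (e.extendSubtype_mem ω hω))).2

/-- Union bound over `l` coordinates, each equal to `o` with probability `1 / (2 * l)`. -/
theorem two_mul_card_hit_le {M : Type*} [Fintype M] (o : M) (l : ℕ) (hl : 0 < l)
    (hM : Fintype.card M = 2 * l) :
    2 * #(univ.filter fun ω : Fin l → M => ∃ j, ω j = o) ≤ Fintype.card (Fin l → M) := by
  have hj : ∀ j : Fin l, #(univ.filter fun ω : Fin l → M => ω j = o) * (2 * l) ≤
      Fintype.card (Fin l → M) := by
    intro j
    have := card_mul_card_le_of_update (fun ω : Fin l → M => ω j = o) j 1 (by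
      intro g
      exact_mod_cast card_le_one.2 fun a ha b hb => by simp_all)
    rw [one_mul, hM] at this
    exact_mod_cast this
  have h1 : #(univ.filter fun ω : Fin l → M => ∃ j, ω j = o) ≤
      ∑ j : Fin l, #(univ.filter fun ω : Fin l → M => ω j = o) := by
    refine le_trans (card_le_card ?_) card_biUnion_le
    intro ω hω
    simpa using hω
  have h2 : (∑ j : Fin l, #(univ.filter fun ω : Fin l → M => ω j = o)) * (2 * l) ≤
      l * Fintype.card (Fin l → M) := by
    rw [sum_mul]
    refine (sum_le_card_nsmul _ _ _ fun j _ => hj j).trans ?_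
    simp
  have h3 := (Nat.mul_le_mul_right (2 * l) h1).trans h2
  refine Nat.le_of_mul_le_mul_left ?_ hl
  linarith

/-- Any two vertices of a robust expander are joined by a short rainbow path that avoids given
small sets of vertices and colours. -/
theorem exists_rainbow_path {V K : Type*} [Fintype V] [Fintype K]
    (G : SimpleGraph V) (κ : Sym2 V → K) (hκ : ProperOn G κ) (H U : Finset V) (Q : Finset K)
    (x y : V) (hx : x ∈ H \ U) (hy : y ∈ H \ U) (η δ : ℝ) (hη : 0 < η) (hη1 : η ≤ 1)
    (hH : IsRobustExpander G H η δ) (l : ℕ) (hl0 : 0 < l)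
    (hδ : 1280 * (l : ℝ) ^ 4 + #U + #Q + l ≤ δ) (hl : (#H : ℝ) < (1 + η / 2) ^ l) :
    ∃ p : G.Walk x y, p.IsPath ∧ p.length ≤ 2 * l ∧ (p.edges.map κ).Nodup ∧
      (∀ e ∈ p.edges, κ e ∉ Q) ∧ ∀ w ∈ p.support, w ∉ U := by
  obtain ⟨M, _, o, hM⟩ : ∃ (M : Type) (_ : Fintype M) (_ : M), Fintype.card M = 2 * l :=
    ⟨Fin (2 * l), inferInstance, ⟨0, by omega⟩, Fintype.card_fin _⟩
  have hl1 : (1 : ℝ) ≤ l := by exact_mod_cast hl0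
  -- With `k = 32 * l ^ 2` and `δ = 1280 * l ^ 4` the exponents become `-8 * l` and `1 - 10 * l`, so
  -- the total failure is at most `3 * l * exp (-8 * l) ≤ 3 / 8`.
  have hfail : l * (2 * Real.exp (-(32 * l ^ 2 : ℕ) / (2 * Fintype.card M)) +
      Real.exp (1 - 1280 * (l : ℝ) ^ 4 / (2 * Fintype.card M * (32 * l ^ 2 : ℕ)))) < 1 / 2 := by
    rw [hM]
    push_cast
    have e1 : -(32 * (l : ℝ) ^ 2) / (2 * (2 * l)) = -(8 * l) := by field_simp; norm_num
    have e2 : 1280 * (l : ℝ) ^ 4 / (2 * (2 * l) * (32 * l ^ 2)) = 10 * l := by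
      field_simp; norm_num
    rw [e1, e2]
    have h1 : Real.exp (1 - 10 * (l : ℝ)) ≤ Real.exp (-(8 * l)) :=
      Real.exp_le_exp.2 (by linarith)
    have h2 := Real.add_one_le_exp (8 * (l : ℝ))
    have h3 : Real.exp (-(8 * (l : ℝ))) * Real.exp (8 * l) = 1 := by rw [← Real.exp_add]; simp
    have h4 := Real.exp_pos (-(8 * (l : ℝ)))
    have h5 : Real.exp (-(8 * (l : ℝ))) * (8 * l) ≤ 1 := by nlinarith
    nlinarith
  have hk : 0 < 32 * l ^ 2 := by positivity
  have hbx := card_not_reach_half_lt o G κ hκ H U Q x hx η _ δ hη hη1 hH _ hk l hδ hl hfail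
  have hby := card_not_reach_half_lt o G κ hκ H U Q y hy η _ δ hη hη1 hH _ hk l hδ hl hfail
  obtain ⟨σ, hσ⟩ := exists_perm_disjoint _ (two_mul_card_hit_le o l hl0 hM)
  -- `τ` applies `σ` to the exposure history of every colour separately. It preserves counts, and no
  -- colour is exposed under both `g` and `τ g`.
  let τ : (Fin l → K → M) ≃ (Fin l → K → M) :=
    ((Equiv.piComm fun _ _ => M).trans (Equiv.piCongrRight fun _ : K => σ)).trans
      (Equiv.piComm fun _ _ => M)
  have hτ : ∀ g j c, τ g j c = σ (fun j => g j c) j := fun _ _ _ => rfl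
  set X := univ.filter fun g : Fin l → K → M =>
      2 * #(reach G κ (H \ U) x (exposed o g l \ Q) l) ≤ #H with hXdef
  set Y := univ.filter fun g : Fin l → K → M =>
      2 * #(reach G κ (H \ U) y (exposed o g l \ Q) l) ≤ #H with hYdef
  set Y' := univ.filter fun g : Fin l → K → M => τ g ∈ Y with hY'def
  have hYY' : #Y' = #Y := card_equiv τ (by simp [hY'def])
  have hlt : #(X ∪ Y') < #(univ : Finset (Fin l → K → M)) := by
    have h1 : (#(X ∪ Y') : ℝ) ≤ #X + #Y := by
      rw [← hYY']; exact_mod_cast card_union_le _ _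
    have h2 : (#(X ∪ Y') : ℝ) < Fintype.card (Fin l → K → M) := by linarith
    rw [card_univ]
    exact_mod_cast h2
  obtain ⟨g, -, hg⟩ := exists_mem_notMem_of_card_lt_card hlt
  rw [mem_union, not_or] at hg
  obtain ⟨hgx, hgy⟩ := hg
  simp only [hXdef, hYdef, hY'def, mem_filter, mem_univ, true_and, not_le] at hgx hgy
  obtain ⟨v, hv⟩ : (reach G κ (H \ U) x (exposed o g l \ Q) l ∩
      reach G κ (H \ U) y (exposed o (τ g) l \ Q) l).Nonempty := by
    refine inter_nonempty_of_card_lt_card_add_card (s := H)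
      (reach_subset.trans sdiff_subset) (reach_subset.trans sdiff_subset) ?_
    omega
  rw [mem_inter] at hv
  obtain ⟨p, p1, p2, p3, p4⟩ := mem_reach.1 hv.1
  obtain ⟨q, q1, q2, q3, q4⟩ := mem_reach.1 hv.2
  have hedges : (p.append q.reverse).edges = p.edges ++ q.edges.reverse := by
    rw [SimpleGraph.Walk.edges_append, SimpleGraph.Walk.edges_reverse]
  have hnodup : ((p.append q.reverse).edges.map κ).Nodup := by
    rw [hedges, List.map_append, List.map_reverse]
    refine List.nodup_append.2 ⟨p2, List.nodup_reverse.2 q2, ?_⟩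
    intro a ha b hb hab
    rw [List.mem_reverse] at hb
    subst hab
    obtain ⟨e, he, rfl⟩ := List.mem_map.1 ha
    obtain ⟨f, hf, hfe⟩ := List.mem_map.1 hb
    have h1 := (mem_sdiff.1 (p3 e he)).1
    have h2 := (mem_sdiff.1 (q3 f hf)).1
    rw [hfe] at h2
    simp only [exposed, mem_filter, mem_univ, true_and, hτ] at h1 h2
    obtain ⟨j, -, hj⟩ := h1
    obtain ⟨j', -, hj'⟩ := h2
    exact hσ (fun j => g j (κ e)) ⟨j, hj⟩ ⟨j', hj'⟩
  refine ⟨(p.append q.reverse).bypass, SimpleGraph.Walk.bypass_isPath _, ?_, ?_, ?_, ?_⟩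
  · refine (SimpleGraph.Walk.length_bypass_le_length _).trans ?_
    rw [SimpleGraph.Walk.length_append, SimpleGraph.Walk.length_reverse]
    omega
  · refine List.Nodup.map_on ?_ (SimpleGraph.Walk.bypass_isPath _).isTrail.edges_nodup
    intro e he f hf hef
    exact List.inj_on_of_nodup_map hnodup (SimpleGraph.Walk.edges_bypass_subset_edges _ he)
      (SimpleGraph.Walk.edges_bypass_subset_edges _ hf) hef
  · intro e he
    have he' := SimpleGraph.Walk.edges_bypass_subset_edges _ he
    rw [hedges, List.mem_append, List.mem_reverse] at he'
    rcases he' with h | h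
    · exact (mem_sdiff.1 (p3 e h)).2
    · exact (mem_sdiff.1 (q3 e h)).2
  · intro w hw
    have hw' := SimpleGraph.Walk.support_bypass_subset_support _ hw
    rw [SimpleGraph.Walk.mem_support_append_iff, SimpleGraph.Walk.support_reverse,
      List.mem_reverse] at hw'
    rcases hw' with h | h
    · exact (mem_sdiff.1 (p4 w h)).2
    · exact (mem_sdiff.1 (q4 w h)).2

/-! ### Greedy construction of the subdivision -/

/-- Branch vertices that can be joined by rainbow paths avoiding small sets of vertices and
colours span a rainbow subdivision of a complete graph. -/
theorem exists_disjoint_rainbow_paths {V K : Type*} {t : ℕ} (G : SimpleGraph V) (κ : Sym2 V → K)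
    (b : Fin t ↪ V) (m : ℕ)
    (hconn : ∀ (i j : Fin t) (U : Finset V) (Q : Finset K), i ≠ j → b i ∉ U → b j ∉ U →
      #U ≤ t + t ^ 2 * (m + 1) → #Q ≤ t ^ 2 * m →
      ∃ p : G.Walk (b i) (b j), p.IsPath ∧ p.length ≤ m ∧ (p.edges.map κ).Nodup ∧
        (∀ e ∈ p.edges, κ e ∉ Q) ∧ ∀ w ∈ p.support, w ∉ U)
    (T : Finset {p : Fin t × Fin t // p.1 < p.2}) :
    ∃ P : ∀ p : {p : Fin t × Fin t // p.1 < p.2}, G.Walk (b p.1.1) (b p.1.2),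
      (∀ p ∈ T, (P p).IsPath ∧ (P p).length ≤ m ∧ ((P p).edges.map κ).Nodup ∧
        ∀ k, b k ∈ (P p).support → k = p.1.1 ∨ k = p.1.2) ∧
      ∀ p ∈ T, ∀ q ∈ T, p ≠ q →
        (∀ x ∈ (P p).support, x ∈ (P q).support → x ∈ Set.range b) ∧
        ∀ e ∈ (P p).edges, ∀ f ∈ (P q).edges, κ e ≠ κ f := by
  induction T using Finset.induction_on with
  | empty =>
    have h : ∀ p : {p : Fin t × Fin t // p.1 < p.2}, Nonempty (G.Walk (b p.1.1) (b p.1.2)) := by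
      intro p
      obtain ⟨w, -⟩ := hconn p.1.1 p.1.2 ∅ ∅ p.2.ne (by simp) (by simp) (by simp) (by simp)
      exact ⟨w⟩
    exact ⟨fun p => (h p).some, by simp, by simp⟩
  | insert r T hr ih =>
    obtain ⟨P, hP, hPP⟩ := ih
    have hTcard : #T ≤ t ^ 2 := by
      refine (card_le_univ T).trans ((Fintype.card_subtype_le _).trans ?_)
      simp [sq]
    -- Only the two current ends are exempt, so the new path avoids other branch vertices and meets
    -- old paths at its ends only.
    let U : Finset V := ((univ.image b) ∪ T.biUnion fun p => (P p).support.toFinset) \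
      {b r.1.1, b r.1.2}
    let Q : Finset K := T.biUnion fun p => ((P p).edges.map κ).toFinset
    have hU : #U ≤ t + t ^ 2 * (m + 1) := by
      refine (card_le_card sdiff_subset).trans ((card_union_le _ _).trans (add_le_add ?_ ?_))
      · exact card_image_le.trans (by simp)
      · refine (card_biUnion_le_card_mul _ _ (m + 1) fun p hp => ?_).trans
          (Nat.mul_le_mul_right _ hTcard)
        refine (List.toFinset_card_le _).trans ?_
        rw [SimpleGraph.Walk.length_support]
        exact Nat.succ_le_succ (hP p hp).2.1
    have hQ : #Q ≤ t ^ 2 * m := by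
      refine (card_biUnion_le_card_mul _ _ m fun p hp => ?_).trans
          (Nat.mul_le_mul_right _ hTcard)
      refine (List.toFinset_card_le _).trans ?_
      rw [List.length_map, SimpleGraph.Walk.length_edges]
      exact (hP p hp).2.1
    obtain ⟨w, w1, w2, w3, w4, w5⟩ := hconn r.1.1 r.1.2 U Q r.2.ne (by simp [U]) (by simp [U]) hU hQ
    have hne : ∀ p ∈ T, p ≠ r := fun p hp h => hr (h ▸ hp)
    have hcross : ∀ p ∈ T, (∀ x ∈ w.support, x ∈ (P p).support → x ∈ Set.range b) ∧
        ∀ e ∈ w.edges, ∀ f ∈ (P p).edges, κ e ≠ κ f := by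
      intro p hp
      constructor
      · intro x hxw hxp
        by_contra hx
        refine w5 x hxw (mem_sdiff.2 ⟨mem_union_right _ (mem_biUnion.2 ⟨p, hp, by simpa⟩), ?_⟩)
        simp only [mem_insert, mem_singleton, not_or]
        exact ⟨fun h => hx ⟨_, h.symm⟩, fun h => hx ⟨_, h.symm⟩⟩
      · intro e he f hf hef
        refine w4 e he (mem_biUnion.2 ⟨p, hp, ?_⟩)
        rw [hef, List.mem_toFinset]
        exact List.mem_map_of_mem hf
    refine ⟨Function.update P r w, ?_, ?_⟩
    · intro p hp
      rcases mem_insert.1 hp with rfl | hp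
      · rw [Function.update_self]
        refine ⟨w1, w2, w3, fun k hk => ?_⟩
        by_contra hcon
        rw [not_or] at hcon
        refine w5 _ hk (mem_sdiff.2 ⟨mem_union_left _ (mem_image_of_mem _ (mem_univ _)), ?_⟩)
        simpa using hcon
      · rw [Function.update_of_ne (hne p hp)]
        exact hP p hp
    · intro p hp q hq hpq
      rcases mem_insert.1 hp with rfl | hpT <;> rcases mem_insert.1 hq with rfl | hqT
      · exact absurd rfl hpq
      · rw [Function.update_self, Function.update_of_ne (hne q hqT)]
        exact hcross q hqT
      · rw [Function.update_self, Function.update_of_ne (hne p hpT)]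
        exact ⟨fun x h1 h2 => (hcross p hpT).1 x h2 h1,
          fun e he f hf h => (hcross p hpT).2 f hf e he h.symm⟩
      · rw [Function.update_of_ne (hne p hpT), Function.update_of_ne (hne q hqT)]
        exact hPP p hpT q hqT hpq

/-! ### Choice of parameters -/

theorem card_adjPairs_univ {V : Type*} [Fintype V] (G : SimpleGraph V) :
    #(adjPairs G univ) = 2 * G.edgeSet.ncard := by
  have h1 : #(adjPairs G univ) = ∑ v, G.degree v := by
    rw [adjPairs, card_filter, univ_product_univ, Fintype.sum_prod_type]
    refine sum_congr rfl fun v _ => ?_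
    rw [← card_filter, ← SimpleGraph.card_neighborFinset_eq_degree]
    congr 1
    ext w; simp
  rw [h1, SimpleGraph.sum_degrees_eq_twice_card_edges, ← SimpleGraph.coe_edgeFinset,
    Set.ncard_coe_finset]

theorem card_adjPairs_le {V : Type*} (G : SimpleGraph V) (S : Finset V) :
    #(adjPairs G S) ≤ #S * #S := by
  rw [← card_product]; exact card_filter_le _ _

/-- Rainbow paths between all pairs of branch vertices, in a graph with a properly coloured
edge set whose average degree is large compared with a power of `log n`. -/
theorem exists_branch_rainbow_paths {V K : Type*} [Fintype V] [Fintype K] [Nonempty V]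
    (G : SimpleGraph V) (κ : Sym2 V → K) (hκ : ProperOn G κ) (t : ℕ) (ht : 1 ≤ t) (d : ℝ)
    (hlog : 1 ≤ Real.log (Fintype.card V))
    (hG : d * Fintype.card V ≤ #(adjPairs G univ))
    (hd : 10 ^ 13 * (t : ℝ) ^ 2 * Real.log (Fintype.card V) ^ 10 ≤ d) :
    ∃ (b : Fin t ↪ V) (m : ℕ), (m : ℝ) ≤ 1300 * Real.log (Fintype.card V) ^ 2 ∧
      ∃ P : ∀ p : {p : Fin t × Fin t // p.1 < p.2}, G.Walk (b p.1.1) (b p.1.2),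
      (∀ p, (P p).IsPath ∧ (P p).length ≤ m ∧ ((P p).edges.map κ).Nodup ∧
        ∀ k, b k ∈ (P p).support → k = p.1.1 ∨ k = p.1.2) ∧
      ∀ p q, p ≠ q →
        (∀ x ∈ (P p).support, x ∈ (P q).support → x ∈ Set.range b) ∧
        ∀ e ∈ (P p).edges, ∀ f ∈ (P q).edges, κ e ≠ κ f := by
  have hnpos : (0 : ℝ) < Fintype.card V := by exact_mod_cast Fintype.card_pos
  set lam := Real.log (Fintype.card V) with hlam
  have ht1 : (1 : ℝ) ≤ t := by exact_mod_cast ht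
  have hdpos : 0 < d := lt_of_lt_of_le (by positivity) hd
  obtain ⟨H, hHne, hHpairs, hHexp⟩ := exists_robustExpander G d hdpos hG
  rw [← hlam] at hHpairs hHexp
  obtain ⟨L, hL⟩ : ∃ L : ℝ, L = 1 + lam := ⟨_, rfl⟩
  rw [← hL] at hHpairs hHexp
  have hL1 : 2 ≤ L := by linarith
  have hL2 : L ≤ 2 * lam := by linarith
  -- The growth rate per round is `1 + 1 / (12 * L) ≥ exp (1 / (24 * L))`, so `24 * L ^ 2` rounds
  -- give `exp L > n`.
  obtain ⟨l, hl⟩ : ∃ l : ℕ, l = ⌈24 * L ^ 2⌉₊ := ⟨_, rfl⟩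
  have hl_lo : 24 * L ^ 2 ≤ l := by rw [hl]; exact Nat.le_ceil _
  have hl_hi : (l : ℝ) ≤ 100 * lam ^ 2 := by
    have := Nat.ceil_lt_add_one (show 0 ≤ 24 * L ^ 2 by positivity)
    rw [← hl] at this
    nlinarith
  have hl1 : (1 : ℝ) ≤ l := by nlinarith
  have hl0 : 0 < l := by exact_mod_cast hl1
  -- `1287 = 1280 + 7`: the 7 pays for the forbidden vertices and colours and for the walk length
  -- `l`.
  have hδ : 1287 * (t : ℝ) ^ 2 * l ^ 4 ≤ d / (12 * L ^ 2) := by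
    rw [le_div_iff₀ (by positivity)]
    calc 1287 * (t : ℝ) ^ 2 * l ^ 4 * (12 * L ^ 2)
        ≤ 1287 * (t : ℝ) ^ 2 * (100 * lam ^ 2) ^ 4 * (12 * (2 * lam) ^ 2) := by gcongr
      _ = 6177600000000 * ((t : ℝ) ^ 2 * lam ^ 10) := by ring
      _ ≤ 10 ^ 13 * ((t : ℝ) ^ 2 * lam ^ 10) := by gcongr; norm_num
      _ ≤ d := by linarith
  have hl4 : (l : ℝ) ≤ l ^ 4 := by
    calc (l : ℝ) = l ^ 1 := (pow_one _).symm
      _ ≤ l ^ 4 := pow_le_pow_right₀ hl1 (by norm_num)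
  have htH : t ≤ #H := by
    have h1 : (#(adjPairs G H) : ℝ) ≤ #H * #H := by exact_mod_cast card_adjPairs_le G H
    have hh : (0 : ℝ) < #H := by exact_mod_cast hHne.card_pos
    have h2 : d / L ≤ #H := le_of_mul_le_mul_right (hHpairs.trans h1) hh
    have h3 : d / (12 * L ^ 2) ≤ d / L := by
      apply div_le_div_of_nonneg_left hdpos.le (by linarith)
      nlinarith
    have h4 : (t : ℝ) ≤ 1287 * (t : ℝ) ^ 2 * l ^ 4 := by
      have h5 : (1 : ℝ) ≤ l ^ 4 := hl1.trans hl4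
      nlinarith [mul_nonneg (sq_nonneg (t : ℝ)) (sub_nonneg.2 h5)]
    exact_mod_cast h4.trans (hδ.trans (h3.trans h2))
  have hgrow : (#H : ℝ) < (1 + 1 / (6 * L) / 2) ^ l := by
    have h1 : (#H : ℝ) ≤ Fintype.card V := by exact_mod_cast card_le_univ H
    have h2 : (Fintype.card V : ℝ) < Real.exp L := by
      rw [hL, add_comm, Real.exp_add, hlam, Real.exp_log hnpos]
      have := Real.add_one_lt_exp (one_ne_zero (α := ℝ))
      nlinarith
    have hx : 1 / (24 * L) ≤ 1 / 48 := one_div_le_one_div_of_le (by norm_num) (by linarith)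
    have hxpos : 0 < 1 / (24 * L) := by positivity
    have h3 : Real.exp (1 / (24 * L)) ≤ 1 + 1 / (6 * L) / 2 := by
      have e1 : 1 / (6 * L) / 2 = 2 * (1 / (24 * L)) := by field_simp; norm_num
      rw [e1]
      set z := 1 / (24 * L) with hz
      have h4 := Real.add_one_le_exp (-z)
      have h5 : Real.exp (-z) * Real.exp z = 1 := by rw [← Real.exp_add]; simp
      have h6 := Real.exp_pos z
      have h7 : (1 - z) * Real.exp z ≤ 1 := by nlinarith
      have h8 : 1 ≤ (1 - z) * (1 + 2 * z) := by nlinarith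
      exact le_of_mul_le_mul_left (h7.trans h8) (by linarith)
    calc (#H : ℝ) < Real.exp L := h1.trans_lt h2
      _ ≤ Real.exp (l * (1 / (24 * L))) := by
          refine Real.exp_le_exp.2 ?_
          rw [mul_one_div, le_div_iff₀ (by positivity)]
          nlinarith
      _ = Real.exp (1 / (24 * L)) ^ l := Real.exp_nat_mul _ _
      _ ≤ _ := by gcongr
  obtain ⟨b', -⟩ : ∃ b' : Fin t ↪ {v // v ∈ H}, True := by
    have : Nonempty (Fin t ↪ {v // v ∈ H}) :=
      Function.Embedding.nonempty_of_card_le (by simpa using htH)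
    exact ⟨this.some, trivial⟩
  let b : Fin t ↪ V := b'.trans (Function.Embedding.subtype _)
  have hbH : ∀ i, b i ∈ H := fun i => (b' i).2
  have hconn : ∀ (i j : Fin t) (U : Finset V) (Q : Finset K), i ≠ j → b i ∉ U → b j ∉ U →
      #U ≤ t + t ^ 2 * (2 * l + 1) → #Q ≤ t ^ 2 * (2 * l) →
      ∃ p : G.Walk (b i) (b j), p.IsPath ∧ p.length ≤ 2 * l ∧ (p.edges.map κ).Nodup ∧
        (∀ e ∈ p.edges, κ e ∉ Q) ∧ ∀ w ∈ p.support, w ∉ U := by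
    intro i j U Q _ hi hj hU hQ
    refine exists_rainbow_path G κ hκ H U Q (b i) (b j) (mem_sdiff.2 ⟨hbH i, hi⟩)
      (mem_sdiff.2 ⟨hbH j, hj⟩) (1 / (6 * L)) _ (by positivity) ?_ hHexp l hl0 ?_ hgrow
    · rw [div_le_one (by positivity)]; linarith
    · refine le_trans ?_ hδ
      have hU' : (#U : ℝ) ≤ t + t ^ 2 * (2 * l + 1) := by exact_mod_cast hU
      have hQ' : (#Q : ℝ) ≤ t ^ 2 * (2 * l) := by exact_mod_cast hQ
      have htt : (t : ℝ) ≤ t ^ 2 := by nlinarith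
      have h1 : (1 : ℝ) ≤ t ^ 2 := ht1.trans htt
      have e1 : (l : ℝ) ^ 4 ≤ t ^ 2 * l ^ 4 := le_mul_of_one_le_left (by positivity) h1
      have e2 : (t : ℝ) ^ 2 * l ≤ t ^ 2 * l ^ 4 := mul_le_mul_of_nonneg_left hl4 (by positivity)
      have e3 : (t : ℝ) ^ 2 ≤ t ^ 2 * l ^ 4 :=
        le_mul_of_one_le_right (by positivity) (hl1.trans hl4)
      linarith
  obtain ⟨P, hP, hPP⟩ := exists_disjoint_rainbow_paths G κ b (2 * l) hconn univ
  refine ⟨b, 2 * l, ?_, P, fun p => hP p (mem_univ p),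
    fun p q => hPP p (mem_univ p) q (mem_univ q)⟩
  push_cast
  nlinarith [sq_nonneg lam]

theorem mem_edgeSet_toSubgraph {V : Type u} {G : SimpleGraph V} {t : ℕ}
    (D : CliqueSubdivision G t) (e : Sym2 V) (he : e ∈ D.toSubgraph.edgeSet) :
    ∃ (i j : Fin t) (h : i < j), e ∈ (D.path i j h : G.Walk (D.branch i) (D.branch j)).edges := by
  simpa [CliqueSubdivision.toSubgraph, SimpleGraph.Subgraph.edgeSet_sup,
    SimpleGraph.Subgraph.edgeSet_iSup] using he

end RainbowSubdivision

/-! ### Proof of the theorem -/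

open RainbowSubdivision in
theorem theorem1 (t : ℕ) (ht : 2 ≤ t) :
    ∃ c : ℝ, 0 < c ∧
      ∀ (n : ℕ), t ≤ n →
        ∀ (V : Type u) [Fintype V] (C : Type v) (G : SimpleGraph V) (χ : G.EdgeLabeling C),
          Fintype.card V = n →
          RainbowSubdivision.IsProper χ →
          (n : ℝ) * Real.exp (c * Real.sqrt (Real.log n)) ≤ (G.edgeSet.ncard : ℝ) →
          ∃ D : RainbowSubdivision.CliqueSubdivision G t,
            RainbowSubdivision.IsRainbow χ D.toSubgraph ∧
            ∀ (i j : Fin t) (h : i < j),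
              ((D.path i j h : G.Walk (D.branch i) (D.branch j)).length : ℝ)
                ≤ 1300 * Real.log n ^ 2 := by
  classical
  have ht2 : (2 : ℝ) ≤ t := by exact_mod_cast ht
  have hf : (1 : ℝ) ≤ (Nat.factorial 20 : ℝ) := by exact_mod_cast Nat.factorial_pos 20
  -- Chosen so that the term `x ^ 20 / 20!` of `exp x` at `x = c * √(log n)` already exceeds the
  -- required degree.
  obtain ⟨c, hc⟩ : ∃ c : ℝ, c = (Nat.factorial 20 : ℝ) * (10 ^ 13 * (t : ℝ) ^ 2) := ⟨_, rfl⟩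
  have hc1 : 1 ≤ c := by
    rw [hc]
    have : (1 : ℝ) ≤ 10 ^ 13 * (t : ℝ) ^ 2 := by nlinarith
    exact one_le_mul_of_one_le_of_one_le hf this
  refine ⟨c, by linarith, ?_⟩
  rintro n hn V _ C G χ rfl hχ hedges
  have hn2 : (2 : ℝ) ≤ Fintype.card V := by exact_mod_cast ht.trans hn
  have hnpos : (0 : ℝ) < Fintype.card V := by linarith
  have hVne : Nonempty V := Fintype.card_pos_iff.1 (by exact_mod_cast hnpos)
  set lam := Real.log (Fintype.card V) with hlam
  have hlampos : 0 < lam := Real.log_pos (by linarith)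
  have hpairs : 2 * Real.exp (c * Real.sqrt lam) * Fintype.card V ≤
      (Finset.card (adjPairs G Finset.univ) : ℝ) := by
    rw [card_adjPairs_univ]; push_cast; linarith
  -- A graph has fewer than `n ^ 2` edges, so the density forces `c ≤ √(log n)`; smaller `n` hold
  -- vacuously.
  have hlog : 1 ≤ lam := by
    have h1 : (Finset.card (adjPairs G Finset.univ) : ℝ) ≤ Fintype.card V * Fintype.card V := by
      exact_mod_cast card_adjPairs_le G Finset.univ
    have h2 : 2 * Real.exp (c * Real.sqrt lam) ≤ Fintype.card V :=
      le_of_mul_le_mul_right (hpairs.trans h1) hnpos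
    have h3 : Real.exp (c * Real.sqrt lam) ≤ Real.exp lam := by
      rw [hlam, Real.exp_log hnpos, ← hlam]
      linarith [Real.exp_pos (c * Real.sqrt lam)]
    have h4 := Real.exp_le_exp.1 h3
    have h5 := Real.mul_self_sqrt hlampos.le
    have h6 := Real.sqrt_pos.2 hlampos
    have h7 : c ≤ Real.sqrt lam := by
      rw [← h5, Real.sqrt_mul_self h6.le] at h4
      exact le_of_mul_le_mul_right h4 h6
    nlinarith
  have hd : 10 ^ 13 * (t : ℝ) ^ 2 * lam ^ 10 ≤ 2 * Real.exp (c * Real.sqrt lam) := by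
    have h1 := Real.pow_div_factorial_le_exp (c * Real.sqrt lam) (by positivity) 20
    have h2 : (c * Real.sqrt lam) ^ 20 = c ^ 20 * lam ^ 10 := by
      rw [mul_pow, show (20 : ℕ) = 2 * 10 from rfl, pow_mul (Real.sqrt lam), Real.sq_sqrt hlampos.le]
    have h3 : c ≤ c ^ 20 := le_self_pow₀ hc1 (by norm_num)
    have h4 : 10 ^ 13 * (t : ℝ) ^ 2 * lam ^ 10 ≤ (c * Real.sqrt lam) ^ 20 / Nat.factorial 20 := by
      rw [le_div_iff₀ (by linarith), h2]
      calc 10 ^ 13 * (t : ℝ) ^ 2 * lam ^ 10 * Nat.factorial 20 = c * lam ^ 10 := by rw [hc]; ring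
        _ ≤ c ^ 20 * lam ^ 10 := mul_le_mul_of_nonneg_right h3 (by positivity)
    linarith [Real.exp_pos (c * Real.sqrt lam)]
  have hedge : Nonempty G.edgeSet := by
    rw [Set.nonempty_coe_sort, Set.nonempty_iff_ne_empty]
    intro h
    rw [h, Set.ncard_empty, Nat.cast_zero] at hedges
    exact absurd hedges (not_le.2 (by positivity))
  let e₀ : G.edgeSet := hedge.some
  -- Restricting to the colours in use makes the palette finite; non-edges get the irrelevant colour
  -- of `e₀`.
  let κ : Sym2 V → Set.range χ := fun e =>
    if h : e ∈ G.edgeSet then ⟨χ ⟨e, h⟩, Set.mem_range_self _⟩ else ⟨χ e₀, Set.mem_range_self _⟩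
  have hκval : ∀ (e : Sym2 V) (h : e ∈ G.edgeSet), (κ e : C) = χ ⟨e, h⟩ := by
    intro e h
    simp only [κ, dif_pos h]
  have hκ : ProperOn G κ := by
    intro a b b' hab hab' heq
    by_contra hne
    refine hχ ⟨s(a, b), hab⟩ ⟨s(a, b'), hab'⟩ ?_ ⟨a, by simp, by simp⟩ ?_
    · intro h
      exact hne (Sym2.congr_right.1 (congrArg Subtype.val h))
    · rw [← hκval _ hab, ← hκval _ hab', heq]
  have : Fintype (Set.range χ) := (Set.finite_range (ι := G.edgeSet) χ).fintype
  obtain ⟨b, m, hm, P, hP, hPP⟩ := exists_branch_rainbow_paths G κ hκ t (by omega)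
    (2 * Real.exp (c * Real.sqrt lam)) hlog hpairs hd
  let D : CliqueSubdivision G t :=
    { branch := b
      path := fun i j h => ⟨P ⟨(i, j), h⟩, (hP ⟨(i, j), h⟩).1⟩
      branch_mem := fun i j h k hk => (hP ⟨(i, j), h⟩).2.2.2 k hk
      disjoint := fun i j h k l h' hne x hx hx' =>
        (hPP ⟨(i, j), h⟩ ⟨(k, l), h'⟩ (fun heq => hne (congrArg Subtype.val heq))).1 x hx hx' }
  refine ⟨D, ?_, fun i j h => ?_⟩
  · intro e f he hf hef
    obtain ⟨i, j, hij, he'⟩ := mem_edgeSet_toSubgraph D e he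
    obtain ⟨k, l, hkl, hf'⟩ := mem_edgeSet_toSubgraph D f hf
    have heq : κ e = κ f := by
      apply Subtype.ext
      rw [hκval _ e.2, hκval _ f.2]
      exact hef
    by_cases hpq : (⟨(i, j), hij⟩ : {p : Fin t × Fin t // p.1 < p.2}) = ⟨(k, l), hkl⟩
    · obtain ⟨rfl, rfl⟩ : i = k ∧ j = l := by simpa using hpq
      exact Subtype.ext (List.inj_on_of_nodup_map (hP ⟨(i, j), hij⟩).2.2.1 he' hf' heq)
    · exact absurd heq ((hPP _ _ hpq).2 _ he' _ hf')
  · refine le_trans ?_ hm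
    exact_mod_cast (hP ⟨(i, j), h⟩).2.1
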